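/- Let $D$ be an integral domain with quotient field $K$, let $F(D)$ be the set of nonzero fractional ideals of $D$, and let $\ast$ be a star-operation on $D$, i.e. a map $A\mapsto A_\ast$ from $F(D)$ to $F(D)$ such that for all $A,B\in F(D)$ and $0\neq x\in K$: $(x)_\ast=(x)$ and $(xA)_\ast=xA_\ast$; $A\subseteq A_\ast$, and $A\subseteq B$ implies $A_\ast\subseteq B_\ast$; $(A_\ast)_\ast=A_\ast$. For $A\in F(D)$ let $A_{\ast_s}=\bigcup\{B_\ast \mid 0\neq B\subseteq A,\ B \text{ a finitely generated fractional ideal}\}$ and $A^{-1}=\{x\in K\mid xA\subseteq D\}$. Assume that $\ast$ has finite character, i.e. $A_\ast=A_{\ast_s}$ for every $A\in F(D)$. Terminology. Let $\mathbb N$ be the set of positive integers. $A\in F(D)$ is $\ast$-invertible if $(AA^{-1})_\ast=D$, and $\ast_s$-invertible if $(AA^{-1})_{\ast_s}=D$. A maximal $\ast$-ideal is an ideal maximal among the proper nonzero ideals $I$ of $D$ with $I_\ast=I$ (such an ideal is prime); $\ast\text{-}\mathrm{Max}(D)$ is the set of these. $D$ is $\ast$-h-local if $D=\bigcap\{D_P\mid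 P\in\ast\text{-}\mathrm{Max}(D)\}$ (an empty intersection being $K$), no two distinct maximal $\ast$-ideals contain a common nonzero prime ideal, and every nonzero nonunit of $D$ lies in only finitely many maximal $\ast$-ideals. A domain $R$ is an almost valuation domain if for all nonzero $a,b\in R$ there is $n\in\mathbb N$ with $a^n\mid b^n$ or $b^n\mid a^n$. $D$ is an AP$\ast$MD if for all nonzero $a,b\in D$ there is $n\in\mathbb N$ such that $(a^n,b^n)$ is $\ast_s$-invertible. An ideal $A$ of $D$ is $P$-$\ast$-homogeneous if it is nonzero and finitely generated and $P$ is the unique maximal $\ast$-ideal containing $A$; it is $\ast$-homogeneous if it is $P$-$\ast$-homogeneous for some $P$. An ideal $A$ of $D$ is $\ast$-almost super-homogeneous if it is $\ast$-invertible and $P$-$\ast$-homogeneous for some $P$ and, whenever $b_1,\dots,b_k\in P$ satisfy $A^r\subseteq(b_1,\dots,b_k)_\ast$ for some $r\in\mathbb N$, there is $n\in\mathbb N$ such that $(b_1^n,\dots,b_k^n)$ is $\ast$-invertible. $D$ is a $\ast$-almost super-SH domain if every nonzero proper principal ideal of $D$ has the form $(A_1\cdots A_m)_\ast$ with finitely many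 $\ast$-almost super-homogeneous ideals $A_1,\dots,A_m$. Theorem. The following statements are equivalent. (1) $D$ is a $\ast$-almost IRKT, i.e. $D$ is $\ast$-h-local and $D_P$ is an almost valuation domain for every maximal $\ast$-ideal $P$. (2) $D$ is $\ast$-h-local and an AP$\ast$MD. (3) $D$ is $\ast$-h-local and every $\ast$-invertible $\ast$-homogeneous ideal of $D$ is $\ast$-almost super-homogeneous. (4) $D$ is a $\ast$-almost super-SH domain. -/

import Mathlib

open scoped nonZeroDivisors

/-- A star-operation on a domain `D` with quotient field `K`: a map `A ↦ A_*` on the nonzero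
fractional ideals of `D` such that `(x)_* = (x)`, `(xA)_* = x A_*`, `A ⊆ A_*`,
`A ⊆ B → A_* ⊆ B_*` and `(A_*)_* = A_*`.
The map is extended to the zero fractional ideal by the normalisation `0_* = 0`; since `A ⊆ A_*`,
it sends nonzero fractional ideals to nonzero fractional ideals. -/
structure StarOperation (D : Type*) [CommRing D] [IsDomain D] (K : Type*) [Field K]
    [Algebra D K] [IsFractionRing D K] where
  /-- The underlying map `A ↦ A_*`. -/
  toFun : FractionalIdeal D⁰ K → FractionalIdeal D⁰ K
  map_zero : toFun 0 = 0
  map_spanSingleton : ∀ x : K, x ≠ 0 →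
    toFun (FractionalIdeal.spanSingleton D⁰ x) = FractionalIdeal.spanSingleton D⁰ x
  map_smul : ∀ (x : K) (A : FractionalIdeal D⁰ K), x ≠ 0 → A ≠ 0 →
    toFun (FractionalIdeal.spanSingleton D⁰ x * A) =
      FractionalIdeal.spanSingleton D⁰ x * toFun A
  le_star : ∀ A : FractionalIdeal D⁰ K, A ≠ 0 → A ≤ toFun A
  mono : ∀ A B : FractionalIdeal D⁰ K, A ≠ 0 → B ≠ 0 → A ≤ B → toFun A ≤ toFun B
  star_star : ∀ A : FractionalIdeal D⁰ K, A ≠ 0 → toFun (toFun A) = toFun A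

namespace StarOperation

variable {D : Type*} [CommRing D] [IsDomain D] {K : Type*} [Field K] [Algebra D K]
  [IsFractionRing D K]

instance : CoeFun (StarOperation D K) fun _ => FractionalIdeal D⁰ K → FractionalIdeal D⁰ K :=
  ⟨StarOperation.toFun⟩

/-- `A_{*_s}`: the union of all `B_*`, where `B` runs through the nonzero finitely generated
fractional ideals contained in `A`. -/
def finiteTypeUnion (s : StarOperation D K) (A : FractionalIdeal D⁰ K) : Set K :=
  {x | ∃ B : FractionalIdeal D⁰ K, B ≠ 0 ∧ (B : Submodule D K).FG ∧ B ≤ A ∧ x ∈ s B}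

/-- `*` is of finite character: `A_* = A_{*_s}` for every nonzero fractional ideal `A`. -/
def IsFiniteCharacter (s : StarOperation D K) : Prop :=
  ∀ A : FractionalIdeal D⁰ K, A ≠ 0 → (s A : Set K) = s.finiteTypeUnion A

/-- `A` is `*`-invertible: `(A A⁻¹)_* = D`. -/
def IsInvertible (s : StarOperation D K) (A : FractionalIdeal D⁰ K) : Prop :=
  A ≠ 0 ∧ s (A * A⁻¹) = 1

/-- `A` is `*_s`-invertible: `(A A⁻¹)_{*_s} = D`. -/
def IsFiniteTypeInvertible (s : StarOperation D K) (A : FractionalIdeal D⁰ K) : Prop :=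
  A ≠ 0 ∧ s.finiteTypeUnion (A * A⁻¹) = ((1 : FractionalIdeal D⁰ K) : Set K)

/-- `I` is an (integral) `*`-ideal: `I` is nonzero and `I_* = I`. -/
def IsStarIdeal (s : StarOperation D K) (I : Ideal D) : Prop :=
  I ≠ ⊥ ∧ s (I : FractionalIdeal D⁰ K) = (I : FractionalIdeal D⁰ K)

/-- `P` is a maximal `*`-ideal: maximal among the proper integral `*`-ideals. -/
def IsMaximalStarIdeal (s : StarOperation D K) (P : Ideal D) : Prop :=
  Maximal (fun I : Ideal D => I ≠ ⊤ ∧ s.IsStarIdeal I) P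

/-- Maximal `*`-ideals are prime, so that `starMax` below misses none of them. -/
theorem IsMaximalStarIdeal.isPrime {s : StarOperation D K} {P : Ideal D}
    (hP : s.IsMaximalStarIdeal P) : P.IsPrime := by
  obtain ⟨⟨hPtop, hPbot, hPs⟩, hmax⟩ := hP
  refine ⟨hPtop, ?_⟩
  intro a b hab
  by_contra! hcon
  obtain ⟨haP, hbP⟩ := hcon
  have hb0 : b ≠ 0 := fun h => hbP (h ▸ P.zero_mem)
  set J : Ideal D := P ⊔ Ideal.span {a} with hJ
  have hPJ : P ≤ J := le_sup_left
  have haJ : a ∈ J := le_sup_right (a := P) (Ideal.mem_span_singleton_self a)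
  have hJ0 : J ≠ ⊥ := fun h => hPbot (le_bot_iff.mp (h ▸ hPJ))
  have hJ0' : (J : FractionalIdeal D⁰ K) ≠ 0 := by
    rwa [Ne, FractionalIdeal.coeIdeal_eq_zero]
  have hP0' : (P : FractionalIdeal D⁰ K) ≠ 0 := by
    rwa [Ne, FractionalIdeal.coeIdeal_eq_zero]
  have hone : s (1 : FractionalIdeal D⁰ K) = 1 := by
    have := s.map_spanSingleton 1 one_ne_zero
    rwa [FractionalIdeal.spanSingleton_one] at this
  have hle : s (J : FractionalIdeal D⁰ K) ≤ 1 := by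
    rw [← hone]
    exact s.mono _ _ hJ0' one_ne_zero FractionalIdeal.coeIdeal_le_one
  obtain ⟨I, hI⟩ := FractionalIdeal.le_one_iff_exists_coeIdeal.mp hle
  have hJI : J ≤ I := by
    rw [← FractionalIdeal.coeIdeal_le_coeIdeal K, hI]
    exact s.le_star _ hJ0'
  have hItop : I = ⊤ := by
    by_contra hne
    have hIP : I ≤ P := by
      refine hmax ⟨hne, fun h => hJ0 (le_bot_iff.mp (h ▸ hJI)), ?_⟩ (hPJ.trans hJI)
      rw [hI]
      exact s.star_star _ hJ0'
    exact haP (hIP (hJI haJ))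
  have hsJ : s (J : FractionalIdeal D⁰ K) = 1 := by
    rw [← hI, hItop, FractionalIdeal.coeIdeal_top]
  have hbK : algebraMap D K b ≠ 0 := by
    simpa using hb0
  have hmul : FractionalIdeal.spanSingleton D⁰ (algebraMap D K b) * (J : FractionalIdeal D⁰ K)
      = ((Ideal.span {b} * J : Ideal D) : FractionalIdeal D⁰ K) := by
    rw [FractionalIdeal.coeIdeal_mul, FractionalIdeal.coeIdeal_span_singleton]
  have hbJ : Ideal.span {b} * J ≤ P := by
    rw [hJ, Ideal.mul_sup, sup_le_iff]
    refine ⟨Ideal.mul_le_right, ?_⟩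
    rw [Ideal.span_singleton_mul_span_singleton, Ideal.span_singleton_le_iff_mem, mul_comm]
    exact hab
  have hbJ0 : ((Ideal.span {b} * J : Ideal D) : FractionalIdeal D⁰ K) ≠ 0 := by
    rw [Ne, FractionalIdeal.coeIdeal_eq_zero, Ideal.mul_eq_bot, not_or]
    exact ⟨by simpa using hb0, hJ0⟩
  have h1 := s.map_smul _ _ hbK hJ0'
  rw [hsJ, mul_one, hmul] at h1
  have h2 := s.mono _ _ hbJ0 hP0' ((FractionalIdeal.coeIdeal_le_coeIdeal K).mpr hbJ)
  rw [h1, hPs, ← FractionalIdeal.coeIdeal_span_singleton,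
    FractionalIdeal.coeIdeal_le_coeIdeal K, Ideal.span_singleton_le_iff_mem] at h2
  exact hbP h2

/-- `*-Max(D)`, the set of maximal `*`-ideals, as a family of prime ideals. -/
def starMax (s : StarOperation D K) : Set (PrimeSpectrum D) :=
  {P | s.IsMaximalStarIdeal P.asIdeal}

end StarOperation

/-- A domain `D` is an almost valuation domain (AV-domain): for all nonzero `a`, `b` there is
`n ≥ 1` with `a ^ n ∣ b ^ n` or `b ^ n ∣ a ^ n`. -/
def IsAlmostValuationDomain (D : Type*) [CommRing D] : Prop :=
  IsDomain D ∧ ∀ a b : D, a ≠ 0 → b ≠ 0 → ∃ n : ℕ, 0 < n ∧ (a ^ n ∣ b ^ n ∨ b ^ n ∣ a ^ n)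

/-- A family `F` of primes is a defining family: `D = ⋂ {D_P | P ∈ F}`, the intersection being
taken in the quotient field `K` (an empty intersection is `K`). -/
def IsDefiningFamily {D : Type*} [CommRing D] [IsDomain D] (K : Type*) [Field K] [Algebra D K]
    [IsFractionRing D K] (F : Set (PrimeSpectrum D)) : Prop :=
  (⨅ P ∈ F, Localization.subalgebra.ofField K P.asIdeal.primeCompl
    P.asIdeal.primeCompl_le_nonZeroDivisors) = (⊥ : Subalgebra D K)

/-- A family `F` of primes is of finite character: every nonzero nonunit of `D` lies in at most
finitely many members of `F`. -/
def IsLocallyFiniteFamily {D : Type*} [CommRing D] (F : Set (PrimeSpectrum D)) : Prop :=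
  ∀ x : D, x ≠ 0 → ¬ IsUnit x → {P ∈ F | x ∈ P.asIdeal}.Finite

/-- A family `F` of primes is independent: no two members contain a common nonzero prime. -/
def IsIndependentFamily {D : Type*} [CommRing D] (F : Set (PrimeSpectrum D)) : Prop :=
  ∀ P ∈ F, ∀ Q ∈ F, P ≠ Q →
    ¬ ∃ p : Ideal D, p.IsPrime ∧ p ≠ ⊥ ∧ p ≤ P.asIdeal ∧ p ≤ Q.asIdeal

namespace StarOperation

variable {D : Type*} [CommRing D] [IsDomain D] {K : Type*} [Field K] [Algebra D K]
  [IsFractionRing D K]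

/-- `D` is `*`-h-local: `*-Max(D)` is an independent defining family of finite character. -/
def IsHLocal (s : StarOperation D K) : Prop :=
  IsDefiningFamily K s.starMax ∧ IsIndependentFamily s.starMax ∧ IsLocallyFiniteFamily s.starMax

/-- `D` is a `*`-almost independent ring of Krull type: `D` is `*`-h-local and `D_P` is an almost
valuation domain for every maximal `*`-ideal `P`. -/
def IsAlmostIRKT (s : StarOperation D K) : Prop :=
  s.IsHLocal ∧ ∀ P ∈ s.starMax, IsAlmostValuationDomain (Localization.AtPrime P.asIdeal)

/-- `D` is an almost Prüfer `*`-multiplication domain (AP`*`MD): for all nonzero `a`, `b` in `D`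
there is `n ≥ 1` such that the ideal `(a ^ n, b ^ n)` is `*_s`-invertible. -/
def IsAPMD (s : StarOperation D K) : Prop :=
  ∀ a b : D, a ≠ 0 → b ≠ 0 → ∃ n : ℕ, 0 < n ∧
    s.IsFiniteTypeInvertible ((Ideal.span {a ^ n, b ^ n} : Ideal D) : FractionalIdeal D⁰ K)

/-- `A` is `P`-`*`-homogeneous: `A` is a nonzero finitely generated ideal, and `P` is the unique
maximal `*`-ideal that contains `A`. -/
def IsHomogeneousAt (s : StarOperation D K) (P A : Ideal D) : Prop :=
  A ≠ ⊥ ∧ A.FG ∧ s.IsMaximalStarIdeal P ∧ A ≤ P ∧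
    ∀ Q : Ideal D, s.IsMaximalStarIdeal Q → A ≤ Q → Q = P

/-- `A` is `*`-homogeneous: nonzero, finitely generated, and contained in a unique maximal
`*`-ideal. -/
def IsHomogeneous (s : StarOperation D K) (A : Ideal D) : Prop :=
  ∃ P : Ideal D, s.IsHomogeneousAt P A

/-- `A` is `*`-almost super-homogeneous: `A` is `*`-invertible and `P`-`*`-homogeneous, and
whenever `b₁, …, b_k ∈ P` satisfy `A ^ r ⊆ (b₁, …, b_k)_*` for some `r ≥ 1`, there is `n ≥ 1` such
that `(b₁ ^ n, …, b_k ^ n)` is `*`-invertible. -/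
def IsAlmostSuperHomogeneous (s : StarOperation D K) (A : Ideal D) : Prop :=
  ∃ P : Ideal D, s.IsInvertible (A : FractionalIdeal D⁰ K) ∧ s.IsHomogeneousAt P A ∧
    ∀ (k : ℕ) (b : Fin k → D), (∀ i, b i ∈ P) →
      (∃ r : ℕ, 0 < r ∧ ((A ^ r : Ideal D) : FractionalIdeal D⁰ K) ≤
        s ((Ideal.span (Set.range b) : Ideal D) : FractionalIdeal D⁰ K)) →
      ∃ n : ℕ, 0 < n ∧
        s.IsInvertible
          ((Ideal.span (Set.range fun i => b i ^ n) : Ideal D) : FractionalIdeal D⁰ K)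

/-- `D` is a `*`-almost super-SH domain: every nonzero proper principal ideal is a `*`-product
`(A₁ ⋯ A_m)_*` of finitely many `*`-almost super-homogeneous ideals. -/
def IsAlmostSuperSH (s : StarOperation D K) : Prop :=
  ∀ x : D, x ≠ 0 → ¬ IsUnit x → ∃ L : List (Ideal D),
    (∀ A ∈ L, s.IsAlmostSuperHomogeneous A) ∧
      ((Ideal.span {x} : Ideal D) : FractionalIdeal D⁰ K) =
        s ((L.prod : Ideal D) : FractionalIdeal D⁰ K)

end StarOperation

/-!
For a star-operation of finite character every question is settled locally at the maximal
`*`-ideals: an ideal `I` with `I_* ≠ D` lies in a maximal `*`-ideal (Zorn), hence `I_*` contains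
every `x` whose image lies in `I D_P` for all maximal `*`-ideals `P`
(`IsFiniteCharacter.algebraMap_mem_star`), and a nonzero finitely generated ideal is `*`-invertible
if and only if all the `A D_P` are principal (`IsFiniteCharacter.isInvertible_iff`). In particular
`D = ⋂ D_P` always holds.

*Almost valuation localizations and the AP`*`MD property.* In a local domain a principal ideal
`(a ^ n, b ^ n)` is generated by `a ^ n` or `b ^ n`, so an AP`*`MD has almost valuation
localizations. Conversely, only finitely many `P` contain `a b`, and the product of the exponents
that work at these `P` works everywhere.

*Homogeneous ideals are super-homogeneous.* If `A ^ r ⊆ (b₁, …, b_k)_*` with `A` homogeneous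
at `P`, then `(b₁, …, b_k)` lies in no other maximal `*`-ideal, and at `P` some `b_i ^ n` divides
all the others.

*Factorization.* Independence says that for `P ≠ Q` the ring generated by `D_P` and `D_Q` is `K`,
so `x D_P ∩ D` is not contained in `Q`. A finitely generated part of it, taken for each of the
finitely many `P ∋ x`, is `*`-invertible and homogeneous (`IsHLocal.exists_component`), and the
`*`-product of these components is `(x)`, by comparison at each maximal `*`-ideal.

*From factorizations back to almost valuation localizations.* Finiteness and independence are
immediate, since a prime containing `x` contains a factor of `(x)`. If `A` is almost
super-homogeneous at `P` and `A D_P = (β)`, the defining property applied to the generators of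
`A ^ k` together with any `c ∈ P` shows that `β ^ k` and `c` are comparable after raising both to
some power (`IsAlmostSuperHomogeneous.exists_map_eq_span`). The elements all of whose powers are
comparable in this sense with everything form a submonoid (`powComparableSubmonoid`), and
up to a unit of `D_P` every nonzero element of `D` is a product of such elements.
-/

/-! ### Comparability of powers -/

/-- Some power of `a` divides, or is divided by, the same power of `b`. -/
def PowComparable {R : Type*} [CommRing R] (a b : R) : Prop :=
  ∃ n : ℕ, 0 < n ∧ (a ^ n ∣ b ^ n ∨ b ^ n ∣ a ^ n)

theorem powComparable_zero_left {R : Type*} [CommRing R] (b : R) : PowComparable 0 b :=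
  ⟨1, one_pos, Or.inr (by simp)⟩

theorem powComparable_zero_right {R : Type*} [CommRing R] (a : R) : PowComparable a 0 :=
  ⟨1, one_pos, Or.inl (by simp)⟩

theorem PowComparable.of_associated {R : Type*} [CommRing R] {a b c d : R}
    (h : PowComparable a b) (hac : Associated a c) (hbd : Associated b d) :
    PowComparable c d := by
  obtain ⟨n, hn, h⟩ := h
  refine ⟨n, hn, h.imp (fun h => ?_) fun h => ?_⟩
  · exact (hac.pow_pow (n := n)).symm.dvd.trans (h.trans (hbd.pow_pow (n := n)).dvd)
  · exact (hbd.pow_pow (n := n)).symm.dvd.trans (h.trans (hac.pow_pow (n := n)).dvd)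

theorem IsAlmostValuationDomain.powComparable {R : Type*} [CommRing R]
    (hR : IsAlmostValuationDomain R) (a b : R) : PowComparable a b := by
  by_cases ha : a = 0
  · exact ha ▸ powComparable_zero_left b
  by_cases hb : b = 0
  · exact hb ▸ powComparable_zero_right a
  exact hR.2 a b ha hb

/-- In an almost valuation domain, a common exponent makes one member of a finite family divide
all the others. -/
theorem IsAlmostValuationDomain.exists_pow_dvd {R ι : Type*} [CommRing R]
    (hR : IsAlmostValuationDomain R) (b : ι → R) {t : Finset ι} (ht : t.Nonempty) :
    ∃ n : ℕ, 0 < n ∧ ∃ i ∈ t, ∀ j ∈ t, b i ^ n ∣ b j ^ n := by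
  classical
  induction ht using Finset.Nonempty.cons_induction with
  | singleton i => exact ⟨1, one_pos, i, by simp, by simp⟩
  | cons i t hi ht ih =>
    obtain ⟨n, hn, j, hj, hdvd⟩ := ih
    obtain ⟨m, hm, hij⟩ := hR.powComparable (b i) (b j)
    refine ⟨m * n, Nat.mul_pos hm hn, ?_⟩
    have key : ∀ l ∈ t, b j ^ (m * n) ∣ b l ^ (m * n) := fun l hl => by
      rw [mul_comm, pow_mul, pow_mul]
      exact pow_dvd_pow_of_dvd (hdvd l hl) m
    rcases hij with h | h
    · have h' := pow_dvd_pow_of_dvd h n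
      rw [← pow_mul, ← pow_mul] at h'
      refine ⟨i, by simp, fun l hl => ?_⟩
      rcases Finset.mem_cons.mp hl with rfl | hl
      · exact dvd_rfl
      · exact h'.trans (key l hl)
    · have h' := pow_dvd_pow_of_dvd h n
      rw [← pow_mul, ← pow_mul] at h'
      refine ⟨j, by simp [hj], fun l hl => ?_⟩
      rcases Finset.mem_cons.mp hl with rfl | hl
      · exact h'
      · exact key l hl

/-- The elements all of whose powers are power-comparable with every nonzero element. Asking this
of all powers `a ^ k`, and not only of `a`, is what makes the set multiplicatively closed. -/
def powComparableSubmonoid (R : Type*) [CommRing R] [IsDomain R] : Submonoid R where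
  carrier := {a | ∀ k : ℕ, ∀ b : R, b ≠ 0 → PowComparable (a ^ k) b}
  one_mem' k b _ := ⟨1, one_pos, Or.inl (by simp)⟩
  mul_mem' := by
    intro a c ha hc k b hb
    obtain ⟨n, hn, h | ⟨d, hd⟩⟩ := ha k b hb
    · -- `b ^ n = a ^ (k n) d`: compare the cofactor `d` with `c ^ (k n)`
      obtain ⟨d, hd⟩ := h
      have hd0 : d ≠ 0 := by
        rintro rfl
        exact hb (eq_zero_of_pow_eq_zero (hd.trans (mul_zero _)))
      obtain ⟨m, hm, hcd⟩ := hc (k * n) d hd0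
      refine ⟨n * m, Nat.mul_pos hn hm, ?_⟩
      have e1 : ((a * c) ^ k) ^ (n * m) = ((a ^ k) ^ n) ^ m * (c ^ (k * n)) ^ m := by
        simp only [← pow_mul, mul_pow, mul_assoc]
      have e2 : b ^ (n * m) = ((a ^ k) ^ n) ^ m * d ^ m := by
        rw [pow_mul, hd, mul_pow]
      rw [e1, e2]
      exact hcd.imp (mul_dvd_mul_left _) (mul_dvd_mul_left _)
    · refine ⟨n, hn, Or.inr ?_⟩
      rw [mul_pow, mul_pow, hd, mul_assoc]
      exact dvd_mul_right _ _

theorem mem_powComparableSubmonoid {R : Type*} [CommRing R] [IsDomain R] {a : R} :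
    a ∈ powComparableSubmonoid R ↔ ∀ k : ℕ, ∀ b : R, b ≠ 0 → PowComparable (a ^ k) b :=
  Iff.rfl

/-! ### Principal ideals in local rings -/

/-- In a local domain, a principal ideal is generated by one member of any generating set: if all
generators lay in `𝔪 c`, so would `c`. -/
theorem exists_mem_span_singleton_of_isPrincipal {R : Type*} [CommRing R] [IsDomain R]
    [IsLocalRing R] {S : Set R} (hS : S.Nonempty) (h : (Ideal.span S).IsPrincipal) :
    ∃ x ∈ S, Ideal.span S = Ideal.span {x} := by
  obtain ⟨c, hc⟩ := h
  change Ideal.span S = Ideal.span {c} at hc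
  by_contra! hcon
  have hc0 : c ≠ 0 := by
    rintro rfl
    obtain ⟨x, hx⟩ := hS
    have : x ∈ Ideal.span {(0 : R)} := hc ▸ Ideal.subset_span hx
    rw [Ideal.mem_span_singleton, zero_dvd_iff] at this
    exact hcon x hx (by rw [hc, this])
  have hle : Ideal.span S ≤ Ideal.span {c} * IsLocalRing.maximalIdeal R := by
    refine Ideal.span_le.mpr fun x hx => ?_
    have hxc : x ∈ Ideal.span {c} := hc ▸ Ideal.subset_span hx
    obtain ⟨u, rfl⟩ := Ideal.mem_span_singleton.mp hxc
    refine Ideal.mul_mem_mul (Ideal.mem_span_singleton_self c) ?_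
    rw [IsLocalRing.mem_maximalIdeal, mem_nonunits_iff]
    intro hu
    exact hcon _ hx (by rw [hc, Ideal.span_singleton_mul_right_unit hu])
  have hcm : c ∈ Ideal.span {c} * IsLocalRing.maximalIdeal R :=
    hle (hc ▸ Ideal.mem_span_singleton_self c)
  obtain ⟨z, hz, hcz⟩ := Ideal.mem_span_singleton_mul.mp hcm
  have : z = 1 := mul_left_cancel₀ hc0 (by rw [hcz, mul_one])
  exact (Ideal.ne_top_iff_one _).mp (IsLocalRing.maximalIdeal.isMaximal R).ne_top (this ▸ hz)

theorem isPrincipal_map_span_of_dvd {D R : Type*} [CommRing D] [CommRing R] (f : D →+* R)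
    {S : Set D} {x : D} (hx : x ∈ S) (h : ∀ y ∈ S, f x ∣ f y) :
    ((Ideal.span S).map f).IsPrincipal := by
  refine ⟨f x, ?_⟩
  change _ = Ideal.span {f x}
  rw [Ideal.map_span]
  refine le_antisymm (Ideal.span_le.mpr ?_) (Ideal.span_mono ?_)
  · rintro _ ⟨y, hy, rfl⟩
    exact Ideal.mem_span_singleton.mpr (h y hy)
  · exact Set.singleton_subset_iff.mpr ⟨x, hx, rfl⟩

/-! ### Localization at a prime -/

section AtPrime

variable {D : Type*} [CommRing D] (P : Ideal D) [P.IsPrime]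

theorem algebraMap_atPrime_mem_map_iff {I : Ideal D} {x : D} :
    algebraMap D (Localization.AtPrime P) x ∈ I.map (algebraMap D (Localization.AtPrime P)) ↔
      ∃ t ∉ P, t * x ∈ I :=
  IsLocalization.algebraMap_mem_map_algebraMap_iff P.primeCompl _ I x

theorem map_atPrime_eq_top {I : Ideal D} (h : ¬ I ≤ P) :
    I.map (algebraMap D (Localization.AtPrime P)) = ⊤ := by
  obtain ⟨x, hx, hxP⟩ := SetLike.not_le_iff_exists.mp h
  exact Ideal.eq_top_of_isUnit_mem _ (Ideal.mem_map_of_mem _ hx)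
    (IsLocalization.map_units _ (⟨x, hxP⟩ : P.primeCompl))

theorem isPrincipal_map_of_not_le {A : Ideal D} (h : ¬ A ≤ P) :
    (A.map (algebraMap D (Localization.AtPrime P))).IsPrincipal := by
  rw [map_atPrime_eq_top P h]
  infer_instance

theorem exists_associated_algebraMap_atPrime (r : Localization.AtPrime P) :
    ∃ a : D, Associated (algebraMap D (Localization.AtPrime P) a) r := by
  obtain ⟨⟨a, t⟩, h⟩ := IsLocalization.surj P.primeCompl r
  obtain ⟨u, hu⟩ := IsLocalization.map_units (Localization.AtPrime P) t
  exact ⟨a, Associated.symm ⟨u, by rw [hu]; exact h⟩⟩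

theorem algebraMap_atPrime_dvd_iff {a b : D} :
    algebraMap D (Localization.AtPrime P) a ∣ algebraMap D (Localization.AtPrime P) b ↔
      ∃ t ∉ P, a ∣ t * b := by
  have := algebraMap_atPrime_mem_map_iff P (I := Ideal.span {a}) (x := b)
  simpa only [Ideal.map_span, Set.image_singleton, Ideal.mem_span_singleton] using this

theorem isAlmostValuationDomain_atPrime [IsDomain D]
    (h : ∀ a b : D, a ≠ 0 → b ≠ 0 → PowComparable (algebraMap D (Localization.AtPrime P) a)
      (algebraMap D (Localization.AtPrime P) b)) :
    IsAlmostValuationDomain (Localization.AtPrime P) := by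
  refine ⟨inferInstance, fun r q hr hq => ?_⟩
  obtain ⟨a, ha⟩ := exists_associated_algebraMap_atPrime P r
  obtain ⟨b, hb⟩ := exists_associated_algebraMap_atPrime P q
  refine (h a b ?_ ?_).of_associated ha hb
  · rintro rfl
    exact hr (by simpa using ha.symm)
  · rintro rfl
    exact hq (by simpa using hb.symm)

theorem powComparable_of_isPrincipal [IsDomain D] {a b : D} {n : ℕ} (hn : 0 < n) (h :
      ((Ideal.span {a ^ n, b ^ n}).map (algebraMap D (Localization.AtPrime P))).IsPrincipal) :
    PowComparable (algebraMap D (Localization.AtPrime P) a)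
      (algebraMap D (Localization.AtPrime P) b) := by
  rw [Ideal.map_span, Set.image_pair, map_pow, map_pow] at h
  obtain ⟨x, hx, hspan⟩ := exists_mem_span_singleton_of_isPrincipal ⟨_, Set.mem_insert _ _⟩ h
  refine ⟨n, hn, ?_⟩
  have hdvd : ∀ y ∈ ({algebraMap D (Localization.AtPrime P) a ^ n,
      algebraMap D (Localization.AtPrime P) b ^ n} : Set _), x ∣ y := fun y hy =>
    Ideal.mem_span_singleton.mp (hspan ▸ Ideal.subset_span hy)
  rcases hx with rfl | rfl
  · exact Or.inl (hdvd _ (Or.inr rfl))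
  · exact Or.inr (hdvd _ (Or.inl rfl))

/-- A principal extension `A D_P` of a finitely generated ideal `A` has a generator in `A`, and one
denominator works for all of `A`. -/
theorem exists_dvd_of_isPrincipal_map [IsDomain D] {A : Ideal D} (hA : A.FG)
    (h : (A.map (algebraMap D (Localization.AtPrime P))).IsPrincipal) :
    ∃ a ∈ A, ∃ t ∉ P, ∀ z ∈ A, a ∣ t * z := by
  classical
  obtain ⟨_, ⟨a, haA, rfl⟩, ha⟩ := exists_mem_span_singleton_of_isPrincipal
    (S := algebraMap D (Localization.AtPrime P) '' A) ⟨_, 0, A.zero_mem, rfl⟩ h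
  obtain ⟨S, rfl⟩ := hA
  have hex : ∀ g : D, ∃ t ∉ P, g ∈ S → a ∣ t * g := by
    intro g
    by_cases hg : g ∈ S
    · have hgm : algebraMap D (Localization.AtPrime P) g ∈
          Ideal.span {algebraMap D (Localization.AtPrime P) a} := by
        rw [← ha]
        exact Ideal.subset_span ⟨g, Ideal.subset_span hg, rfl⟩
      obtain ⟨t, ht, hd⟩ :=
        (algebraMap_atPrime_dvd_iff P).mp (Ideal.mem_span_singleton.mp hgm)
      exact ⟨t, ht, fun _ => hd⟩
    · exact ⟨1, (Ideal.ne_top_iff_one P).mp Ideal.IsPrime.ne_top', fun h => absurd h hg⟩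
  choose t ht hd using hex
  refine ⟨a, haA, ∏ g ∈ S, t g, prod_mem (S := P.primeCompl) fun g _ => ht g, fun z hz => ?_⟩
  rw [← Ideal.mem_span_singleton]
  have hle : Ideal.span (S : Set D) ≤
      Submodule.comap (LinearMap.mulLeft D (∏ g ∈ S, t g)) (Ideal.span {a}) := by
    refine Ideal.span_le.mpr fun g hg => ?_
    rw [SetLike.mem_coe, Submodule.mem_comap, LinearMap.mulLeft_apply, Ideal.mem_span_singleton,
      ← Finset.prod_erase_mul S t hg, mul_assoc]
    exact (hd g hg).mul_left _
  exact hle hz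

end AtPrime

theorem Ideal.IsPrime.exists_mem_list_le {D : Type*} [CommRing D] {p : Ideal D} (hp : p.IsPrime)
    {L : List (Ideal D)}
    (h : L.prod ≤ p) : ∃ A ∈ L, A ≤ p := by
  rw [← Multiset.prod_coe, hp.multiset_prod_le] at h
  exact h

/-- Independence of `P` and `Q` means that `D_P D_Q = K`: no nonzero prime avoids the
multiplicative set generated by the complements of `P` and `Q`. -/
theorem IsIndependentFamily.exists_dvd_mul {D : Type*} [CommRing D]
    {F : Set (PrimeSpectrum D)}
    (hF : IsIndependentFamily F) {P Q : PrimeSpectrum D} (hP : P ∈ F) (hQ : Q ∈ F) (hne : P ≠ Q)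
    {x : D} (hx : x ≠ 0) : ∃ t ∉ Q.asIdeal, ∃ u ∉ P.asIdeal, x ∣ u * t := by
  by_contra! hcon
  obtain ⟨p, hp, hxp, hdisj⟩ := Ideal.exists_le_prime_disjoint (Ideal.span {x})
    (P.asIdeal.primeCompl ⊔ Q.asIdeal.primeCompl) (by
      rw [Set.disjoint_left]
      intro z hz hzS
      obtain ⟨u, hu, t, ht, rfl⟩ := Submonoid.mem_sup.mp hzS
      exact hcon t ht u hu (Ideal.mem_span_singleton.mp hz))
  rw [Set.disjoint_left] at hdisj
  refine hF P hP Q hQ hne ⟨p, hp, ?_, fun z hz => ?_, fun z hz => ?_⟩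
  · rintro rfl
    exact hx (by simpa using hxp)
  · by_contra hzP
    exact hdisj hz (Submonoid.mem_sup_left (T := Q.asIdeal.primeCompl) hzP)
  · by_contra hzQ
    exact hdisj hz (Submonoid.mem_sup_right (S := P.asIdeal.primeCompl) hzQ)

/-! ### Star-operations of finite character -/

namespace StarOperation

variable {D : Type*} [CommRing D] [IsDomain D] {K : Type*} [Field K] [Algebra D K]
  [IsFractionRing D K] {s : StarOperation D K}

theorem star_one : s 1 = 1 := by
  simpa using s.map_spanSingleton 1 one_ne_zero

theorem star_span_singleton (s : StarOperation D K) {x : D} (hx : x ≠ 0) :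
    s ((Ideal.span {x} : Ideal D) : FractionalIdeal D⁰ K) =
      ((Ideal.span {x} : Ideal D) : FractionalIdeal D⁰ K) := by
  rw [FractionalIdeal.coeIdeal_span_singleton]
  exact s.map_spanSingleton _ (by simpa using hx)

theorem star_span_singleton_mul (s : StarOperation D K) {x : D} (hx : x ≠ 0) {J : Ideal D}
    (hJ : J ≠ ⊥) :
    s ((Ideal.span {x} * J : Ideal D) : FractionalIdeal D⁰ K) =
      FractionalIdeal.spanSingleton D⁰ (algebraMap D K x) * s (J : FractionalIdeal D⁰ K) := by
  rw [FractionalIdeal.coeIdeal_mul, FractionalIdeal.coeIdeal_span_singleton]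
  exact s.map_smul _ _ (by simpa using hx) (FractionalIdeal.coeIdeal_ne_zero.mpr hJ)

theorem exists_coeIdeal_eq_star (s : StarOperation D K) {I : Ideal D} (hI : I ≠ ⊥) :
    ∃ J : Ideal D, I ≤ J ∧ (J : FractionalIdeal D⁰ K) = s (I : FractionalIdeal D⁰ K) := by
  have hle : s (I : FractionalIdeal D⁰ K) ≤ 1 := by
    rw [← star_one (s := s)]
    exact s.mono _ _ (FractionalIdeal.coeIdeal_ne_zero.mpr hI) one_ne_zero
      FractionalIdeal.coeIdeal_le_one
  obtain ⟨J, hJ⟩ := FractionalIdeal.le_one_iff_exists_coeIdeal.mp hle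
  refine ⟨J, ?_, hJ⟩
  rw [← FractionalIdeal.coeIdeal_le_coeIdeal K, hJ]
  exact s.le_star _ (FractionalIdeal.coeIdeal_ne_zero.mpr hI)

/-- Finite character makes the union of a chain of `*`-ideals a `*`-ideal, so Zorn's lemma yields
maximal `*`-ideals. -/
theorem IsFiniteCharacter.exists_le_starMax (hs : s.IsFiniteCharacter) {I : Ideal D} (hI : I ≠ ⊥)
    (hI1 : s (I : FractionalIdeal D⁰ K) ≠ 1) : ∃ P ∈ s.starMax, I ≤ P.asIdeal := by
  obtain ⟨J, hIJ, hJ⟩ := s.exists_coeIdeal_eq_star hI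
  have hJ0 : J ≠ ⊥ := fun h => hI (le_bot_iff.mp (h ▸ hIJ))
  have hJmem : J ∈ {J : Ideal D | J ≠ ⊤ ∧ s.IsStarIdeal J} := by
    refine ⟨?_, hJ0, ?_⟩
    · rintro rfl
      exact hI1 (by rw [← hJ, FractionalIdeal.coeIdeal_top])
    · rw [hJ]
      exact s.star_star _ (FractionalIdeal.coeIdeal_ne_zero.mpr hI)
  suffices h : ∃ P, J ≤ P ∧ Maximal (· ∈ {J : Ideal D | J ≠ ⊤ ∧ s.IsStarIdeal J}) P by
    obtain ⟨P, hJP, hP⟩ := h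
    have hPmax : s.IsMaximalStarIdeal P := hP
    exact ⟨⟨P, hPmax.isPrime⟩, hPmax, hIJ.trans hJP⟩
  refine zorn_le_nonempty₀ _ ?_ J hJmem
  intro c hc hchain y hy
  have hne : c.Nonempty := ⟨y, hy⟩
  have hU0 : sSup c ≠ ⊥ := fun h => (hc hy).2.1 (le_bot_iff.mp (h ▸ le_sSup hy))
  refine ⟨sSup c, ⟨?_, hU0, ?_⟩, fun z hz => le_sSup hz⟩
  · intro htop
    have h1 : (1 : D) ∈ sSup c := htop ▸ Submodule.mem_top
    obtain ⟨z, hz, h1z⟩ := (Submodule.mem_sSup_of_directed hne hchain.directedOn).mp h1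
    exact (hc hz).1 ((Ideal.eq_top_iff_one z).mpr h1z)
  · refine le_antisymm (fun x hx => ?_) (s.le_star _ (FractionalIdeal.coeIdeal_ne_zero.mpr hU0))
    have hx' : x ∈ s.finiteTypeUnion ((sSup c : Ideal D) : FractionalIdeal D⁰ K) :=
      hs _ (FractionalIdeal.coeIdeal_ne_zero.mpr hU0) ▸ hx
    obtain ⟨B, hB0, hBfg, hBU, hxB⟩ := hx'
    obtain ⟨B, rfl⟩ := FractionalIdeal.le_one_iff_exists_coeIdeal.mp
      (hBU.trans FractionalIdeal.coeIdeal_le_one)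
    rw [FractionalIdeal.coeIdeal_fg D⁰ (IsFractionRing.injective D K)] at hBfg
    rw [FractionalIdeal.coeIdeal_le_coeIdeal K] at hBU
    obtain ⟨z, hz, hBz⟩ :=
      (CompleteLattice.isCompactElement_iff_le_of_directed_sSup_le (Ideal D) B).mp
        ((Submodule.fg_iff_compact B).mp hBfg) c hne hchain.directedOn hBU
    have hxz : x ∈ s (z : FractionalIdeal D⁰ K) :=
      s.mono _ _ hB0 (FractionalIdeal.coeIdeal_ne_zero.mpr (hc hz).2.1)
        ((FractionalIdeal.coeIdeal_le_coeIdeal K).mpr hBz) hxB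
    rw [(hc hz).2.2] at hxz
    exact (FractionalIdeal.coeIdeal_le_coeIdeal K).mpr (le_sSup hz) hxz

theorem not_le_of_star_eq_one {I : Ideal D} (hI : I ≠ ⊥)
    (h : s (I : FractionalIdeal D⁰ K) = 1) {P : PrimeSpectrum D} (hP : P ∈ s.starMax) :
    ¬ I ≤ P.asIdeal := by
  intro hIP
  have hP' : s.IsMaximalStarIdeal P.asIdeal := hP
  have h1 := s.mono _ _ (FractionalIdeal.coeIdeal_ne_zero.mpr hI)
    (FractionalIdeal.coeIdeal_ne_zero.mpr hP'.1.2.1)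
    ((FractionalIdeal.coeIdeal_le_coeIdeal K).mpr hIP)
  rw [h, hP'.1.2.2, ← FractionalIdeal.coeIdeal_top, FractionalIdeal.coeIdeal_le_coeIdeal K] at h1
  exact hP'.1.1 (top_le_iff.mp h1)

theorem IsFiniteCharacter.star_eq_one_iff (hs : s.IsFiniteCharacter) {I : Ideal D} (hI : I ≠ ⊥) :
    s (I : FractionalIdeal D⁰ K) = 1 ↔ ∀ P ∈ s.starMax, ¬ I ≤ P.asIdeal := by
  refine ⟨fun h P hP => not_le_of_star_eq_one hI h hP, fun h => ?_⟩
  by_contra hne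
  obtain ⟨P, hP, hIP⟩ := hs.exists_le_starMax hI hne
  exact h P hP hIP

/-- `⋂ I D_P ⊆ I_*`, the intersection being over the maximal `*`-ideals: the ideal `(I : x)` lies
in no maximal `*`-ideal, so its `*`-closure is `D`. -/
theorem IsFiniteCharacter.algebraMap_mem_star (hs : s.IsFiniteCharacter) {I : Ideal D}
    (hI : I ≠ ⊥) {x : D} (h : ∀ P ∈ s.starMax, ∃ t ∉ P.asIdeal, t * x ∈ I) :
    algebraMap D K x ∈ s (I : FractionalIdeal D⁰ K) := by
  by_cases hx : x = 0
  · rw [hx, _root_.map_zero]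
    exact FractionalIdeal.zero_mem _
  let J : Ideal D := Submodule.comap (LinearMap.toSpanSingleton D D x) I
  have hmem : ∀ t, t ∈ J ↔ t * x ∈ I := fun t => Iff.rfl
  have hIJ : I ≤ J := fun t ht => (hmem t).mpr (I.mul_mem_right x ht)
  have hJ0 : J ≠ ⊥ := fun h => hI (le_bot_iff.mp (h ▸ hIJ))
  have hJ1 : s (J : FractionalIdeal D⁰ K) = 1 := by
    refine (hs.star_eq_one_iff hJ0).mpr fun P hP hle => ?_
    obtain ⟨t, ht, htx⟩ := h P hP
    exact ht (hle ((hmem t).mpr htx))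
  have hxJ : Ideal.span {x} * J ≤ I := by
    refine Ideal.span_singleton_mul_le_iff.mpr fun t ht => ?_
    rw [mul_comm]
    exact ht
  have hxJ0 : Ideal.span {x} * J ≠ ⊥ := by
    rw [Ne, Ideal.mul_eq_bot, not_or, Ideal.span_singleton_eq_bot]
    exact ⟨hx, hJ0⟩
  have key := s.mono _ _ (FractionalIdeal.coeIdeal_ne_zero.mpr hxJ0)
    (FractionalIdeal.coeIdeal_ne_zero.mpr hI)
    ((FractionalIdeal.coeIdeal_le_coeIdeal K).mpr hxJ)
  rw [s.star_span_singleton_mul hx hJ0, hJ1, mul_one] at key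
  exact key (FractionalIdeal.mem_spanSingleton_self _ _)

theorem IsFiniteCharacter.dvd_of_forall (hs : s.IsFiniteCharacter) {a x : D} (ha : a ≠ 0)
    (h : ∀ P ∈ s.starMax, ∃ t ∉ P.asIdeal, a ∣ t * x) : a ∣ x := by
  have := hs.algebraMap_mem_star (I := Ideal.span {a}) (x := x) (by simpa using ha)
    (by simpa only [Ideal.mem_span_singleton] using h)
  rw [s.star_span_singleton ha, FractionalIdeal.mem_coeIdeal] at this
  obtain ⟨y, hy, hyx⟩ := this
  rw [← IsFractionRing.injective D K hyx]
  exact Ideal.mem_span_singleton.mp hy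

theorem le_span_singleton_of_eq_star {x : D} {I : Ideal D}
    (h : ((Ideal.span {x} : Ideal D) : FractionalIdeal D⁰ K) = s (I : FractionalIdeal D⁰ K)) :
    I ≤ Ideal.span {x} := by
  by_cases hI : I = ⊥
  · exact hI ▸ bot_le
  rw [← FractionalIdeal.coeIdeal_le_coeIdeal K, h]
  exact s.le_star _ (FractionalIdeal.coeIdeal_ne_zero.mpr hI)

/-- If `I_*` is the principal ideal `(a)`, then `I D_P = a D_P` for every maximal `*`-ideal `P`. -/
theorem map_eq_span_of_star_eq_span {I : Ideal D} {a : D} (ha : a ≠ 0)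
    (h : ((Ideal.span {a} : Ideal D) : FractionalIdeal D⁰ K) = s (I : FractionalIdeal D⁰ K))
    {P : PrimeSpectrum D} (hP : P ∈ s.starMax) :
    I.map (algebraMap D (Localization.AtPrime P.asIdeal)) =
      Ideal.span {algebraMap D (Localization.AtPrime P.asIdeal) a} := by
  have hI : I ≠ ⊥ := by
    rintro rfl
    rw [FractionalIdeal.coeIdeal_bot, s.map_zero, FractionalIdeal.coeIdeal_eq_zero] at h
    exact ha (Ideal.span_singleton_eq_bot.mp h)
  have hIa : I ≤ Ideal.span {a} := le_span_singleton_of_eq_star h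
  obtain ⟨J, rfl⟩ : ∃ J, I = Ideal.span {a} * J := by
    refine ⟨Submodule.comap (LinearMap.mulLeft D a) I, ?_⟩
    refine (Ideal.eq_span_singleton_mul _ _).mpr ⟨fun z hz => ?_, fun z hz => hz⟩
    obtain ⟨w, rfl⟩ := Ideal.mem_span_singleton.mp (hIa hz)
    exact ⟨w, hz, rfl⟩
  have hJ : J ≠ ⊥ := by
    rintro rfl
    exact hI (by simp)
  have hJ1 : s (J : FractionalIdeal D⁰ K) = 1 := by
    rw [s.star_span_singleton_mul ha hJ, FractionalIdeal.coeIdeal_span_singleton] at h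
    have haK : algebraMap D K a ≠ 0 := by simpa using ha
    rw [← FractionalIdeal.spanSingleton_inv_mul K haK]
    nth_rewrite 2 [h]
    rw [← mul_assoc, FractionalIdeal.spanSingleton_inv_mul K haK, one_mul]
  rw [Ideal.map_mul, map_atPrime_eq_top _ (not_le_of_star_eq_one hJ hJ1 hP), Ideal.mul_top,
    Ideal.map_span, Set.image_singleton]

/-! ### Invertibility is local -/

theorem mul_inv_coeIdeal_ne_zero {A : Ideal D} (hA : A ≠ ⊥) :
    (A : FractionalIdeal D⁰ K) * (A : FractionalIdeal D⁰ K)⁻¹ ≠ 0 := by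
  intro h
  have := FractionalIdeal.coe_ideal_le_self_mul_inv K A
  rw [h] at this
  exact FractionalIdeal.coeIdeal_ne_zero.mpr hA (FractionalIdeal.le_zero_iff.mp this)

theorem IsFiniteCharacter.isFiniteTypeInvertible_iff (hs : s.IsFiniteCharacter) (A : Ideal D) :
    s.IsFiniteTypeInvertible (A : FractionalIdeal D⁰ K) ↔
      s.IsInvertible (A : FractionalIdeal D⁰ K) := by
  refine and_congr_right fun hA => ?_
  rw [← hs _ (mul_inv_coeIdeal_ne_zero fun h => hA (by simp [h]))]
  exact SetLike.coe_injective.eq_iff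

/-- For finite character, a finitely generated ideal is `*`-invertible if and only if its
extensions to the localizations at the maximal `*`-ideals are principal. -/
theorem IsFiniteCharacter.isInvertible_iff (hs : s.IsFiniteCharacter) {A : Ideal D} (hA : A ≠ ⊥)
    (hfg : A.FG) :
    s.IsInvertible (A : FractionalIdeal D⁰ K) ↔ ∀ P ∈ s.starMax,
      (A.map (algebraMap D (Localization.AtPrime P.asIdeal))).IsPrincipal := by
  have hAK : (A : FractionalIdeal D⁰ K) ≠ 0 := FractionalIdeal.coeIdeal_ne_zero.mpr hA
  obtain ⟨I, hI⟩ : ∃ I : Ideal D,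
      (I : FractionalIdeal D⁰ K) = A * (A : FractionalIdeal D⁰ K)⁻¹ := by
    rw [← FractionalIdeal.le_one_iff_exists_coeIdeal, FractionalIdeal.inv_eq]
    exact FractionalIdeal.mul_one_div_le_one
  have hI0 : I ≠ ⊥ := by
    rintro rfl
    exact mul_inv_coeIdeal_ne_zero (K := K) hA (by rw [← hI, FractionalIdeal.coeIdeal_bot])
  rw [IsInvertible, and_iff_right hAK, ← hI, hs.star_eq_one_iff hI0]
  refine forall₂_congr fun P hP => ⟨fun h => ?_, fun h hIP => ?_⟩
  · -- some product `a y` with `a ∈ A`, `y ∈ A⁻¹` is a unit at `P`, and then `a` generates `A D_P`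
    rw [← FractionalIdeal.coeIdeal_le_coeIdeal K, hI, FractionalIdeal.mul_le] at h
    push Not at h
    obtain ⟨i, hi, y, hy, hiy⟩ := h
    obtain ⟨a, ha, rfl⟩ := (FractionalIdeal.mem_coeIdeal D⁰).mp hi
    rw [FractionalIdeal.mem_inv_iff hAK] at hy
    obtain ⟨u, hu⟩ := (FractionalIdeal.mem_one_iff D⁰).mp (hy _ hi)
    have huP : u ∉ P.asIdeal := fun h => hiy (by
      rw [mul_comm, ← hu]
      exact FractionalIdeal.mem_coeIdeal_of_mem D⁰ h)
    refine ⟨algebraMap D _ a, le_antisymm (Ideal.map_le_iff_le_comap.mpr fun z hz => ?_) ?_⟩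
    · obtain ⟨w, hw⟩ := (FractionalIdeal.mem_one_iff D⁰).mp
        (hy _ (FractionalIdeal.mem_coeIdeal_of_mem D⁰ hz))
      refine Ideal.mem_span_singleton.mpr ((algebraMap_atPrime_dvd_iff _).mpr ⟨u, huP, w, ?_⟩)
      apply IsFractionRing.injective D K
      rw [map_mul, map_mul, hu, hw]
      ring
    · exact (Ideal.span_singleton_le_iff_mem _).mpr (Ideal.mem_map_of_mem _ ha)
  · -- with `t A ⊆ a D`, the element `t = a (t / a)` lies in `A A⁻¹`
    obtain ⟨a, ha, t, ht, hd⟩ := exists_dvd_of_isPrincipal_map P.asIdeal hfg h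
    have ha0 : a ≠ 0 := by
      rintro rfl
      obtain ⟨z, hz, hz0⟩ := Submodule.exists_mem_ne_zero_of_ne_bot hA
      rcases mul_eq_zero.mp (zero_dvd_iff.mp (hd z hz)) with h | h
      · exact ht (h ▸ P.asIdeal.zero_mem)
      · exact hz0 h
    have haK : algebraMap D K a ≠ 0 := by simpa using ha0
    have hy : algebraMap D K t / algebraMap D K a ∈ (A : FractionalIdeal D⁰ K)⁻¹ := by
      rw [FractionalIdeal.mem_inv_iff hAK]
      intro z hz
      obtain ⟨z, hzA, rfl⟩ := (FractionalIdeal.mem_coeIdeal D⁰).mp hz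
      obtain ⟨w, hw⟩ := hd z hzA
      refine (FractionalIdeal.mem_one_iff D⁰).mpr ⟨w, ?_⟩
      rw [div_mul_eq_mul_div, ← map_mul, hw, map_mul, mul_div_cancel_left₀ _ haK]
    have htI := FractionalIdeal.mul_mem_mul
      (FractionalIdeal.mem_coeIdeal_of_mem (P := K) D⁰ ha) hy
    rw [mul_div_cancel₀ _ haK, ← hI, FractionalIdeal.mem_coeIdeal] at htI
    obtain ⟨t', ht', h'⟩ := htI
    exact ht (hIP (IsFractionRing.injective D K h' ▸ ht'))

theorem IsFiniteCharacter.isDefiningFamily (hs : s.IsFiniteCharacter) :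
    IsDefiningFamily K s.starMax := by
  refine eq_bot_iff.mpr fun x hx => ?_
  obtain ⟨a, b, hb, rfl⟩ := IsFractionRing.div_surjective D x
  have hb0 : b ≠ 0 := nonZeroDivisors.ne_zero hb
  have hbK : algebraMap D K b ≠ 0 := by simpa using hb0
  obtain ⟨c, rfl⟩ : b ∣ a := by
    refine hs.dvd_of_forall hb0 fun P hP => ?_
    have hxP := (Algebra.mem_iInf.mp (Algebra.mem_iInf.mp hx P)) hP
    obtain ⟨c, t, ht, h⟩ := hxP
    have htK : algebraMap D K t ≠ 0 := by
      have : t ≠ 0 := fun h0 => ht (h0 ▸ P.asIdeal.zero_mem)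
      simpa using this
    refine ⟨t, ht, c, IsFractionRing.injective D K ?_⟩
    rw [map_mul, map_mul]
    field_simp at h
    linear_combination h
  rw [map_mul, mul_div_cancel_left₀ _ hbK]
  exact Subalgebra.algebraMap_mem _ c

/-! ### Almost valuation localizations and almost Prüfer multiplication domains -/

theorem IsFiniteCharacter.isAlmostValuationDomain_of_isAPMD (hs : s.IsFiniteCharacter)
    (h : s.IsAPMD) {P : PrimeSpectrum D} (hP : P ∈ s.starMax) :
    IsAlmostValuationDomain (Localization.AtPrime P.asIdeal) := by
  refine isAlmostValuationDomain_atPrime _ fun a b ha hb => ?_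
  obtain ⟨n, hn, hinv⟩ := h a b ha hb
  rw [hs.isFiniteTypeInvertible_iff] at hinv
  have hne : Ideal.span {a ^ n, b ^ n} ≠ ⊥ := fun h0 =>
    pow_ne_zero n ha (Ideal.span_eq_bot.mp h0 _ (Set.mem_insert _ _))
  exact powComparable_of_isPrincipal _ hn
    ((hs.isInvertible_iff hne (Submodule.fg_span (Set.toFinite _))).mp hinv P hP)

theorem IsAlmostIRKT.isAPMD (hs : s.IsFiniteCharacter) (h : s.IsAlmostIRKT) : s.IsAPMD := by
  intro a b ha hb
  have hab : a * b ≠ 0 := mul_ne_zero ha hb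
  -- outside the finitely many maximal `*`-ideals that contain `a b`, both elements are units
  have hfin : {P ∈ s.starMax | a * b ∈ P.asIdeal}.Finite := by
    by_cases hu : IsUnit (a * b)
    · convert Set.finite_empty
      refine Set.eq_empty_of_forall_notMem fun P hP => ?_
      exact P.isPrime.ne_top (Ideal.eq_top_of_isUnit_mem _ hP.2 hu)
    · exact h.1.2.2 _ hab hu
  have hex : ∀ P : PrimeSpectrum D, ∃ n : ℕ, 0 < n ∧ (P ∈ s.starMax →
      (algebraMap D (Localization.AtPrime P.asIdeal) a ^ n ∣
          algebraMap D (Localization.AtPrime P.asIdeal) b ^ n ∨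
        algebraMap D (Localization.AtPrime P.asIdeal) b ^ n ∣
          algebraMap D (Localization.AtPrime P.asIdeal) a ^ n)) := by
    intro P
    by_cases hP : P ∈ s.starMax
    · obtain ⟨n, hn, h⟩ := (h.2 P hP).powComparable (algebraMap D _ a) (algebraMap D _ b)
      exact ⟨n, hn, fun _ => h⟩
    · exact ⟨1, one_pos, fun h => absurd h hP⟩
  choose n hn hdvd using hex
  set N := ∏ P ∈ hfin.toFinset, n P with hN
  have hNpos : 0 < N := Finset.prod_pos fun P _ => hn P
  refine ⟨N, hNpos, ?_⟩
  have hne : Ideal.span {a ^ N, b ^ N} ≠ ⊥ := fun h0 =>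
    pow_ne_zero N ha (Ideal.span_eq_bot.mp h0 _ (Set.mem_insert _ _))
  rw [hs.isFiniteTypeInvertible_iff,
    hs.isInvertible_iff hne (Submodule.fg_span (Set.toFinite _))]
  intro P hP
  by_cases habP : a * b ∈ P.asIdeal
  · obtain ⟨m, hm⟩ : n P ∣ N := Finset.dvd_prod_of_mem n (hfin.mem_toFinset.mpr ⟨hP, habP⟩)
    rcases hdvd P hP with h' | h'
    · refine isPrincipal_map_span_of_dvd _ (x := a ^ N) (by simp) ?_
      rintro y (rfl | rfl)
      · exact dvd_rfl
      · rw [map_pow, map_pow, hm, pow_mul, pow_mul]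
        exact pow_dvd_pow_of_dvd h' m
    · refine isPrincipal_map_span_of_dvd _ (x := b ^ N) (by simp) ?_
      rintro y (rfl | rfl)
      · rw [map_pow, map_pow, hm, pow_mul, pow_mul]
        exact pow_dvd_pow_of_dvd h' m
      · exact dvd_rfl
  · refine isPrincipal_map_of_not_le _ fun hle => habP ?_
    exact P.asIdeal.mul_mem_right b
      (P.isPrime.mem_of_pow_mem N (hle (Ideal.subset_span (by simp))))

/-! ### Homogeneous ideals over almost valuation localizations -/

theorem span_range_pow_ne_bot {k : ℕ} {b : Fin k → D} (h : Ideal.span (Set.range b) ≠ ⊥) (n : ℕ) :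
    Ideal.span (Set.range fun i => b i ^ n) ≠ ⊥ := by
  contrapose! h
  rw [Ideal.span_eq_bot] at h ⊢
  rintro _ ⟨i, rfl⟩
  exact eq_zero_of_pow_eq_zero (h _ ⟨i, rfl⟩)

theorem IsFiniteCharacter.isAlmostSuperHomogeneous (hs : s.IsFiniteCharacter)
    (hAV : ∀ P ∈ s.starMax, IsAlmostValuationDomain (Localization.AtPrime P.asIdeal))
    {A : Ideal D} (hinv : s.IsInvertible (A : FractionalIdeal D⁰ K)) (hA : s.IsHomogeneous A) :
    s.IsAlmostSuperHomogeneous A := by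
  obtain ⟨P, hP⟩ := hA
  refine ⟨P, hinv, hP, ?_⟩
  rintro k b - ⟨r, -, hle⟩
  obtain ⟨hA0, -, hPmax, -, huniq⟩ := hP
  have hb0 : Ideal.span (Set.range b) ≠ ⊥ := by
    intro h0
    rw [h0, FractionalIdeal.coeIdeal_bot, s.map_zero, FractionalIdeal.le_zero_iff,
      FractionalIdeal.coeIdeal_eq_zero] at hle
    exact pow_ne_zero r hA0 hle
  have : Nonempty (Fin k) := by
    by_contra hempty
    rw [not_nonempty_iff] at hempty
    exact hb0 (by simp [Set.range_eq_empty])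
  have := hPmax.isPrime
  obtain ⟨n, hn, i, -, hi⟩ := (hAV ⟨P, hPmax.isPrime⟩ hPmax).exists_pow_dvd
    (fun i => algebraMap D (Localization.AtPrime P) (b i)) (Finset.univ_nonempty (α := Fin k))
  refine ⟨n, hn, ?_⟩
  rw [hs.isInvertible_iff (span_range_pow_ne_bot hb0 n) (Submodule.fg_span (Set.finite_range _))]
  intro Q hQ
  by_cases hQP : Q.asIdeal = P
  · obtain rfl : Q = ⟨P, hPmax.isPrime⟩ := PrimeSpectrum.ext hQP
    refine isPrincipal_map_span_of_dvd _ (x := b i ^ n) ⟨i, rfl⟩ ?_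
    rintro _ ⟨j, rfl⟩
    simpa only [map_pow] using hi j (Finset.mem_univ j)
  · -- `P` is the only maximal `*`-ideal containing `b₁, …, b_k`
    refine isPrincipal_map_of_not_le _ fun hQle => hQP (huniq _ hQ ?_)
    have hbQ : Ideal.span (Set.range b) ≤ Q.asIdeal := by
      rw [Ideal.span_le]
      rintro _ ⟨j, rfl⟩
      exact Q.isPrime.mem_of_pow_mem n (hQle (Ideal.subset_span ⟨j, rfl⟩))
    have hQ' : s.IsMaximalStarIdeal Q.asIdeal := hQ
    have h1 := hle.trans (s.mono _ _ (FractionalIdeal.coeIdeal_ne_zero.mpr hb0)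
      (FractionalIdeal.coeIdeal_ne_zero.mpr hQ'.1.2.1)
      ((FractionalIdeal.coeIdeal_le_coeIdeal K).mpr hbQ))
    rw [hQ'.1.2.2, FractionalIdeal.coeIdeal_le_coeIdeal K] at h1
    exact Q.isPrime.le_of_pow_le h1

/-! ### Factorization of principal ideals in an h-local domain -/

/-- The `P`-component of a nonzero nonunit `x ∈ P`: a finitely generated ideal between `(x)` and
`x D_P ∩ D` that lies in no maximal `*`-ideal other than `P`. The full contraction `x D_P ∩ D`
need not be finitely generated. -/
theorem IsHLocal.exists_component (hs : s.IsFiniteCharacter) (h : s.IsHLocal) {x : D}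
    (hx : x ≠ 0) (hxu : ¬ IsUnit x) {P : PrimeSpectrum D} (hP : P ∈ s.starMax)
    (hxP : x ∈ P.asIdeal) :
    ∃ A : Ideal D, s.IsInvertible (A : FractionalIdeal D⁰ K) ∧ s.IsHomogeneousAt P.asIdeal A ∧
      x ∈ A ∧ ∀ z ∈ A, ∃ t ∉ P.asIdeal, x ∣ t * z := by
  have hfin := h.2.2 x hx hxu
  have hex : ∀ Q : PrimeSpectrum D, ∃ t : D, (Q ∈ s.starMax → Q ≠ P → t ∉ Q.asIdeal) ∧
      ∃ u ∉ P.asIdeal, x ∣ u * t := by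
    intro Q
    by_cases hQ : Q ∈ s.starMax ∧ Q ≠ P
    · obtain ⟨t, ht, hu⟩ := h.2.1.exists_dvd_mul hP hQ.1 hQ.2.symm hx
      exact ⟨t, fun _ _ => ht, hu⟩
    · exact ⟨0, fun h1 h2 => absurd ⟨h1, h2⟩ hQ, 1,
        (Ideal.ne_top_iff_one _).mp P.isPrime.ne_top, by simp⟩
  choose t ht hu using hex
  set A : Ideal D := Ideal.span (insert x (t '' {Q ∈ s.starMax | x ∈ Q.asIdeal})) with hA
  have hxA : x ∈ A := Ideal.subset_span (Set.mem_insert _ _)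
  have hgen : ∀ y ∈ insert x (t '' {Q ∈ s.starMax | x ∈ Q.asIdeal}),
      algebraMap D (Localization.AtPrime P.asIdeal) x ∣ algebraMap D _ y := by
    rintro y (rfl | ⟨Q, -, rfl⟩)
    · exact dvd_rfl
    · exact (algebraMap_atPrime_dvd_iff _).mpr (hu Q)
  have hA0 : A ≠ ⊥ := fun h0 => hx (by simpa [h0] using hxA)
  have hfg : A.FG := Submodule.fg_span ((hfin.image t).insert x)
  have hAx : ∀ z ∈ A, ∃ t ∉ P.asIdeal, x ∣ t * z := by
    intro z hz
    rw [← algebraMap_atPrime_dvd_iff, ← Ideal.mem_span_singleton, ← Ideal.mem_comap]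
    refine Ideal.span_le.mpr (fun y hy => ?_) hz
    exact Ideal.mem_comap.mpr (Ideal.mem_span_singleton.mpr (hgen y hy))
  have hAP : A ≤ P.asIdeal := by
    intro z hz
    obtain ⟨u, hu, hd⟩ := hAx z hz
    exact (P.isPrime.mem_or_mem (Ideal.mem_of_dvd _ hd hxP)).resolve_left hu
  have huniq : ∀ Q ∈ s.starMax, A ≤ Q.asIdeal → Q = P := by
    intro Q hQ hAQ
    by_contra hne
    exact ht Q hQ hne (hAQ (Ideal.subset_span (Or.inr ⟨Q, ⟨hQ, hAQ hxA⟩, rfl⟩)))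
  refine ⟨A, (hs.isInvertible_iff hA0 hfg).mpr fun Q hQ => ?_,
    ⟨hA0, hfg, hP, hAP, fun Q hQ hAQ => ?_⟩, hxA, hAx⟩
  · by_cases hQP : Q = P
    · subst hQP
      exact isPrincipal_map_span_of_dvd _ (Set.mem_insert _ _) hgen
    · exact isPrincipal_map_of_not_le _ fun hAQ => hQP (huniq Q hQ hAQ)
  · exact congrArg PrimeSpectrum.asIdeal (huniq ⟨Q, hQ.isPrime⟩ hQ hAQ)

theorem IsHLocal.isAlmostSuperSH (hs : s.IsFiniteCharacter) (h : s.IsHLocal)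
    (hhom : ∀ A : Ideal D, s.IsInvertible (A : FractionalIdeal D⁰ K) → s.IsHomogeneous A →
      s.IsAlmostSuperHomogeneous A) : s.IsAlmostSuperSH := by
  classical
  intro x hx hxu
  have hfin := h.2.2 x hx hxu
  set F := hfin.toFinset with hF
  have hex : ∀ P : PrimeSpectrum D, ∃ A : Ideal D, P ∈ F →
      (s.IsInvertible (A : FractionalIdeal D⁰ K) ∧ s.IsHomogeneousAt P.asIdeal A ∧
      x ∈ A ∧ ∀ z ∈ A, ∃ t ∉ P.asIdeal, x ∣ t * z) := by
    intro P
    by_cases hP : P ∈ F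
    · obtain ⟨hP', hxP⟩ := hfin.mem_toFinset.mp hP
      obtain ⟨A, hA⟩ := h.exists_component hs hx hxu hP' hxP
      exact ⟨A, fun _ => hA⟩
    · exact ⟨⊥, fun h => absurd h hP⟩
  choose A hA using hex
  refine ⟨F.toList.map A, ?_, ?_⟩
  · intro B hB
    obtain ⟨P, hP, rfl⟩ := List.mem_map.mp hB
    obtain ⟨h1, h2, -⟩ := hA P (Finset.mem_toList.mp hP)
    exact hhom _ h1 ⟨_, h2⟩
  rw [Finset.prod_map_toList]
  have hprod0 : ∏ P ∈ F, A P ≠ ⊥ :=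
    Finset.prod_ne_zero_iff.mpr fun P hP => (hA P hP).2.1.1
  refine le_antisymm ?_ ?_
  · -- `x ∈ (∏ A_P)_*`: at `P`, all factors other than `A_P ∋ x` are trivial
    have hmem : algebraMap D K x ∈ s ((∏ P ∈ F, A P : Ideal D) : FractionalIdeal D⁰ K) := by
      refine hs.algebraMap_mem_star hprod0 fun P hP => ?_
      have hnle : ¬ ∏ Q ∈ F.erase P, A Q ≤ P.asIdeal := by
        intro hle
        obtain ⟨Q, hQ, hQP⟩ := (P.isPrime.prod_le).mp hle
        obtain ⟨hne, hQF⟩ := Finset.mem_erase.mp hQ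
        exact hne (PrimeSpectrum.ext ((hA Q hQF).2.1.2.2.2.2 _ hP hQP).symm)
      obtain ⟨t, ht, htP⟩ := SetLike.not_le_iff_exists.mp hnle
      refine ⟨t, htP, ?_⟩
      by_cases hPF : P ∈ F
      · rw [← Finset.prod_erase_mul F A hPF]
        exact Ideal.mul_mem_mul ht (hA P hPF).2.2.1
      · rw [Finset.erase_eq_of_notMem hPF] at ht
        exact Ideal.mul_mem_right _ _ ht
    rw [FractionalIdeal.coeIdeal_span_singleton]
    exact FractionalIdeal.spanSingleton_le_iff_mem.mpr hmem
  · rw [← s.star_span_singleton hx]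
    refine s.mono _ _ (FractionalIdeal.coeIdeal_ne_zero.mpr hprod0)
      (FractionalIdeal.coeIdeal_ne_zero.mpr (by simpa using hx))
      ((FractionalIdeal.coeIdeal_le_coeIdeal K).mpr fun z hz => ?_)
    refine Ideal.mem_span_singleton.mpr (hs.dvd_of_forall hx fun P hP => ?_)
    by_cases hxP : x ∈ P.asIdeal
    · have hPF : P ∈ F := hfin.mem_toFinset.mpr ⟨hP, hxP⟩
      exact (hA P hPF).2.2.2 z
        (Ideal.prod_le_inf.trans (Finset.inf_le hPF) hz)
    · exact ⟨x, hxP, dvd_mul_right x z⟩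

/-! ### Domains with almost super-homogeneous factorization -/

theorem IsAlmostSuperSH.isIndependentFamily (h : s.IsAlmostSuperSH) :
    IsIndependentFamily s.starMax := by
  rintro P hP Q hQ hne ⟨p, hp, hp0, hpP, hpQ⟩
  obtain ⟨x, hxp, hx⟩ := Submodule.exists_mem_ne_zero_of_ne_bot hp0
  obtain ⟨L, hL, hxL⟩ := h x hx fun hu => hp.ne_top (Ideal.eq_top_of_isUnit_mem _ hxp hu)
  obtain ⟨A, hA, hAp⟩ := hp.exists_mem_list_le ((le_span_singleton_of_eq_star hxL).trans
    ((Ideal.span_singleton_le_iff_mem _).mpr hxp))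
  obtain ⟨N, -, hN, -⟩ := hL A hA
  exact hne (PrimeSpectrum.ext ((hN.2.2.2.2 _ hP (hAp.trans hpP)).trans
    (hN.2.2.2.2 _ hQ (hAp.trans hpQ)).symm))

theorem IsAlmostSuperSH.isLocallyFiniteFamily (h : s.IsAlmostSuperSH) :
    IsLocallyFiniteFamily s.starMax := by
  intro x hx hxu
  obtain ⟨L, hL, hxL⟩ := h x hx hxu
  have hchoose : ∀ A : Ideal D, ∃ N : Ideal D, A ∈ L → s.IsHomogeneousAt N A := by
    intro A
    by_cases hA : A ∈ L
    · obtain ⟨N, -, hN, -⟩ := hL A hA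
      exact ⟨N, fun _ => hN⟩
    · exact ⟨⊥, fun h => absurd h hA⟩
  choose N hN using hchoose
  have hfin : (N '' {A | A ∈ L}).Finite := (List.finite_toSet L).image N
  refine (hfin.preimage (f := PrimeSpectrum.asIdeal)
    (fun P _ Q _ hPQ => PrimeSpectrum.ext hPQ)).subset ?_
  rintro P ⟨hP, hxP⟩
  obtain ⟨A, hA, hAP⟩ := P.isPrime.exists_mem_list_le ((le_span_singleton_of_eq_star hxL).trans
    ((Ideal.span_singleton_le_iff_mem _).mpr hxP))
  exact ⟨A, hA, ((hN A hA).2.2.2.2 _ hP hAP).symm⟩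

/-- The extension to `D_P` of an almost super-homogeneous ideal `A` is generated by an element `a`
all of whose powers are power-comparable with every element: the defining property of `A` applies
to the generators of `A ^ k` together with an arbitrary `c ∈ P`. -/
theorem IsAlmostSuperHomogeneous.exists_map_eq_span (hs : s.IsFiniteCharacter) {A : Ideal D}
    (hA : s.IsAlmostSuperHomogeneous A) {P : PrimeSpectrum D} (hP : P ∈ s.starMax) :
    ∃ a ∈ powComparableSubmonoid (Localization.AtPrime P.asIdeal),
      A.map (algebraMap D (Localization.AtPrime P.asIdeal)) = Ideal.span {a} := by
  obtain ⟨N, hinv, hN, hsuper⟩ := hA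
  by_cases hNP : P.asIdeal = N
  swap
  · refine ⟨1, one_mem _, ?_⟩
    rw [map_atPrime_eq_top _ fun hAP => hNP (hN.2.2.2.2 _ hP hAP), Ideal.span_singleton_one]
  subst hNP
  obtain ⟨a, ha⟩ := (hs.isInvertible_iff hN.1 hN.2.1).mp hinv P hP
  change _ = Ideal.span {a} at ha
  refine ⟨a, fun k b hb => ?_, ha⟩
  rcases Nat.eq_zero_or_pos k with rfl | hk
  · exact ⟨1, one_pos, Or.inl (by simp)⟩
  obtain ⟨c, hc⟩ := exists_associated_algebraMap_atPrime P.asIdeal b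
  by_cases hcP : c ∈ P.asIdeal
  swap
  · refine ⟨1, one_pos, Or.inr ?_⟩
    have hbu : IsUnit b := hc.isUnit (IsLocalization.map_units _ (⟨c, hcP⟩ : P.asIdeal.primeCompl))
    exact (hbu.pow 1).dvd
  obtain ⟨m, g, hg⟩ := Submodule.fg_iff_exists_fin_generating_family.mp (hN.2.1.pow (n := k))
  have hgA : ∀ i, g i ∈ A ^ k := fun i => hg ▸ Submodule.subset_span ⟨i, rfl⟩
  have hAk : (A ^ k).map (algebraMap D (Localization.AtPrime P.asIdeal)) = Ideal.span {a ^ k} := by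
    rw [Ideal.map_pow, ha, Ideal.span_singleton_pow]
  have hAle : A ^ k ≤ Ideal.span (Set.range (Fin.cons c g : Fin (m + 1) → D)) := by
    rw [← hg, Fin.range_cons]
    exact Submodule.span_mono (Set.subset_insert _ _)
  have hAk0 : A ^ k ≠ ⊥ := pow_ne_zero k hN.1
  have hspan0 : Ideal.span (Set.range (Fin.cons c g : Fin (m + 1) → D)) ≠ ⊥ := fun h0 =>
    hAk0 (le_bot_iff.mp (h0 ▸ hAle))
  obtain ⟨n, hn, hinvn⟩ := hsuper (m + 1) (Fin.cons c g)
    (Fin.cases hcP fun i => hN.2.2.2.1 (Ideal.pow_le_self hk.ne' (hgA i)))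
    ⟨k, hk, ((FractionalIdeal.coeIdeal_le_coeIdeal K).mpr hAle).trans
      (s.le_star _ (FractionalIdeal.coeIdeal_ne_zero.mpr hspan0))⟩
  rw [hs.isInvertible_iff (span_range_pow_ne_bot hspan0 n)
    (Submodule.fg_span (Set.finite_range _))] at hinvn
  have hprinc := hinvn P hP
  rw [Ideal.map_span] at hprinc
  obtain ⟨_, ⟨_, ⟨i, rfl⟩, rfl⟩, hi⟩ :=
    exists_mem_span_singleton_of_isPrincipal
      ((Set.range_nonempty _).image _) hprinc
  have hdvd : ∀ j,
      algebraMap D (Localization.AtPrime P.asIdeal) (Fin.cons (α := fun _ => D) c g i) ^ n ∣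
        algebraMap D (Localization.AtPrime P.asIdeal) (Fin.cons (α := fun _ => D) c g j) ^ n := by
    intro j
    rw [← map_pow, ← map_pow, ← Ideal.mem_span_singleton, ← hi]
    exact Ideal.subset_span ⟨_, ⟨j, rfl⟩, rfl⟩
  refine PowComparable.of_associated ?_ (Associated.refl (a ^ k)) hc
  refine ⟨n, hn, ?_⟩
  induction i using Fin.cases with
  | zero =>
    -- `c ^ n` divides the `n`-th powers of the generators, one of which generates `A ^ k D_P`
    right
    have hgk : Ideal.span (algebraMap D (Localization.AtPrime P.asIdeal) '' Set.range g) =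
        Ideal.span {a ^ k} := by
      rw [← hAk, ← hg]
      exact (Ideal.map_span _ _).symm
    have hm : (Set.range g).Nonempty := by
      rw [Set.nonempty_iff_ne_empty]
      intro h0
      rw [h0, Submodule.span_empty] at hg
      exact hAk0 hg.symm
    obtain ⟨_, ⟨_, ⟨j, rfl⟩, rfl⟩, hj⟩ := exists_mem_span_singleton_of_isPrincipal
      (hm.image (algebraMap D (Localization.AtPrime P.asIdeal))) ⟨_, hgk⟩
    have h1 := hdvd j.succ
    rw [Fin.cons_zero, Fin.cons_succ] at h1
    refine h1.trans (pow_dvd_pow_of_dvd ?_ n)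
    rw [← Ideal.mem_span_singleton, ← hj, hgk]
    exact Ideal.mem_span_singleton_self _
  | succ i =>
    left
    have h1 := hdvd 0
    rw [Fin.cons_zero, Fin.cons_succ] at h1
    refine (pow_dvd_pow_of_dvd ?_ n).trans h1
    rw [← Ideal.mem_span_singleton, ← hAk]
    exact Ideal.mem_map_of_mem _ (hgA i)

theorem IsAlmostSuperSH.isAlmostValuationDomain (hs : s.IsFiniteCharacter) (h : s.IsAlmostSuperSH)
    {P : PrimeSpectrum D} (hP : P ∈ s.starMax) :
    IsAlmostValuationDomain (Localization.AtPrime P.asIdeal) := by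
  have hlist : ∀ L : List (Ideal D), (∀ A ∈ L, s.IsAlmostSuperHomogeneous A) →
      ∃ a ∈ powComparableSubmonoid (Localization.AtPrime P.asIdeal),
        L.prod.map (algebraMap D (Localization.AtPrime P.asIdeal)) = Ideal.span {a} := by
    intro L
    induction L with
    | nil =>
      intro _
      refine ⟨1, one_mem _, ?_⟩
      rw [List.prod_nil, Ideal.one_eq_top, Ideal.map_top, Ideal.span_singleton_one]
    | cons B L ih =>
      intro hL
      obtain ⟨a, ha, haL⟩ := ih fun A hA => hL A (List.mem_cons_of_mem _ hA)
      obtain ⟨b, hb, hbB⟩ := (hL B List.mem_cons_self).exists_map_eq_span hs hP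
      refine ⟨b * a, mul_mem hb ha, ?_⟩
      rw [List.prod_cons, Ideal.map_mul, haL, hbB, Ideal.span_singleton_mul_span_singleton]
  refine isAlmostValuationDomain_atPrime _ fun a b ha hb => ?_
  have hb' : algebraMap D (Localization.AtPrime P.asIdeal) b ≠ 0 := by simpa using hb
  by_cases hau : IsUnit a
  · exact ⟨1, one_pos, Or.inl (((hau.map _).pow 1).dvd)⟩
  obtain ⟨L, hL, haL⟩ := h a ha hau
  obtain ⟨c, hc, hcL⟩ := hlist L hL
  rw [map_eq_span_of_star_eq_span ha haL hP, Ideal.span_singleton_eq_span_singleton] at hcL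
  exact (pow_one c ▸ mem_powComparableSubmonoid.mp hc 1 _ hb').of_associated hcL.symm
    (Associated.refl _)

end StarOperation

theorem theorem3p2 {D : Type*} [CommRing D] [IsDomain D] {K : Type*} [Field K] [Algebra D K]
    [IsFractionRing D K] (s : StarOperation D K) (hs : s.IsFiniteCharacter) :
    List.TFAE
      [s.IsAlmostIRKT,
        s.IsHLocal ∧ s.IsAPMD,
        s.IsHLocal ∧ ∀ A : Ideal D, s.IsInvertible (A : FractionalIdeal D⁰ K) →
          s.IsHomogeneous A → s.IsAlmostSuperHomogeneous A,
        s.IsAlmostSuperSH] := by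
  tfae_have 1 → 2 := fun h => ⟨h.1, h.isAPMD hs⟩
  tfae_have 2 → 1 := fun h => ⟨h.1, fun _ hP => hs.isAlmostValuationDomain_of_isAPMD h.2 hP⟩
  tfae_have 1 → 3 := fun h => ⟨h.1, fun _ => hs.isAlmostSuperHomogeneous h.2⟩
  tfae_have 3 → 4 := fun h => h.1.isAlmostSuperSH hs h.2
  tfae_have 4 → 1 := fun h =>
    ⟨⟨hs.isDefiningFamily, h.isIndependentFamily, h.isLocallyFiniteFamily⟩,
      fun _ hP => h.isAlmostValuationDomain hs hP⟩
  tfae_finish
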